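/- **Setting.** The cuckoo hashing scheme $\mathsf{CH}(k,b,\ell,s)$ (with $k,b,\ell\ge 1$, $s\ge 0$, $k\mid b$) has a table of $b$ entries that hold at most $\ell$ items each, split into $k$ disjoint sub-tables of $b/k$ entries, and a stash that holds at most $s$ items. Hash functions $H_1,\dots,H_k$ map identifiers to $\{1,\dots,b/k\}$; an item $(\mathsf{id},v)$ may be stored in the entry $H_i(\mathsf{id})$ of the $i$-th sub-table for any $i$, or in the stash. The (perfect) construction algorithm outputs an allocation of a given set of $n$ items with distinct identifiers if one exists, and fails ($\perp$) otherwise. $H$ is a random hash function: all values $H_i(\mathsf{id})$ are independent and uniform. Consider a family of such schemes, indexed by $t\in\mathbb N$, with sizes $n=n_t\to\infty$, security parameters $\lambda=\lambda_t\ge n_t$, parameters $k_t,b_t,\ell_t,s_t$, a non-empty value universe, and an identifier universe $\{0,1,2,\dots\}$, infinite or of finite size superpolynomial in $\lambda$ (for every constant $c$ at least $\lambda_t^c$ for all large $t$). An adversary is a probabilistic random access machine (one fixed program for all $t$, with unit-cost addition and subtraction, coin flips and oracle access to $H_1,\dots,H_k$) that receives $n,\lambda,k,b,\ell,s$. The family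 is $(\lambda,\epsilon)$-robust if every adversary whose number of steps is always bounded by a polynomial in $n$ and $\lambda$ satisfies, for all large $t$, $$\Pr[\text{the adversary outputs } n \text{ items with distinct identifiers for which the construction fails}]\le\epsilon ,$$ over the random hash functions and the coins. **Theorem.** Suppose that $\ell=o(n)$, $s=o(n)$, $b=O(n/\ell)$, and that the query overhead satisfies $k\ell+s<n$ for all large $t$ (in particular this holds if the query overhead is sub-linear). If $H$ is a random hash function and $\mathsf{CH}(k,b,\ell,s)$ is $(\lambda,1/2)$-robust, then $k=\omega(\log\lambda)$, i.e. $k_t/\log\lambda_t\to\infty$ as $t\to\infty$. -/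

import Mathlib

open Filter Asymptotics MeasureTheory

namespace Cuckoo

/-! ### The cuckoo hashing scheme with disjoint sub-tables and a stash -/

/-- Parameters of the cuckoo hashing scheme `CH(k, b, ℓ, s)`: `k` hash functions, `b` entries that
are split into `k` disjoint sub-tables of `b / k` entries, `ℓ` slots per entry, a stash of `s`
slots. -/
structure Params where
  k : ℕ
  b : ℕ
  ℓ : ℕ
  s : ℕ
  k_pos : 1 ≤ k
  b_pos : 1 ≤ b
  ℓ_pos : 1 ≤ ℓ
  k_dvd_b : k ∣ b

/-- The number of entries of each sub-table. -/
def Params.m (P : Params) : ℕ := P.b / P.k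

instance Params.instNeZeroM (P : Params) : NeZero P.m :=
  ⟨(Nat.div_pos (Nat.le_of_dvd P.b_pos P.k_dvd_b) P.k_pos).ne'⟩

/-- A universe with `N` elements, `N` finite or infinite; its elements are named `0, 1, 2, …`. -/
abbrev Universe (N : ℕ∞) : Type := {x : ℕ // (x : ℕ∞) < N}

/-- An item: an identifier together with a value. -/
abbrev Item (N V : ℕ∞) : Type := Universe N × Universe V

/-- The `k` hash functions: `H (i, x)` is the entry that `x` is assigned in the sub-table `i`. -/
abbrev HashFns (P : Params) (N : ℕ∞) : Type := Fin P.k × Universe N → Fin P.m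

/-- The law of `k` independent uniformly random functions. -/
noncomputable def hashLaw (P : Params) (N : ℕ∞) : Measure (HashFns P N) :=
  Measure.infinitePi fun _ => (PMF.uniformOfFintype (Fin P.m)).toMeasure

/-- A storage location: a slot of an entry of a sub-table, or a slot of the stash. -/
abbrev Location (P : Params) : Type := (Fin P.k × Fin P.m × Fin P.ℓ) ⊕ Fin P.s

/-- The locations that may hold an identifier: all slots of its `k` entries, and the stash. -/
def Admissible {P : Params} {N : ℕ∞} (H : HashFns P N) (x : Universe N) : Location P → Prop
  | Sum.inl (i, e, _) => e = H (i, x)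
  | Sum.inr _ => True

/-- A hash table: every location is empty or holds one item. -/
abbrev Table (P : Params) (N V : ℕ∞) : Type := Location P → Option (Item N V)

/-- `T` is a successful allocation of the item set `X`: it holds only items of `X`, each at an
admissible location, and it holds all of them. -/
def Allocates {P : Params} {N V : ℕ∞} (H : HashFns P N) (X : Set (Item N V))
    (T : Table P N V) : Prop :=
  (∀ p a, T p = some a → a ∈ X ∧ Admissible H a.1 p) ∧ ∀ a ∈ X, ∃ p, T p = some a

open Classical in
/-- The perfect construction algorithm: a successful allocation if there is one, otherwise the
failure symbol `none`. -/
noncomputable def construct {P : Params} {N V : ℕ∞} (H : HashFns P N) (X : Set (Item N V)) :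
    Option (Table P N V) :=
  if h : ∃ T, Allocates H X T then some h.choose else none

/-! ### Adversaries: probabilistic oracle random access machines with a step count -/

/-- Programs of a random access machine with registers, an indirectly addressed memory, addition
and truncated subtraction (no multiplication), fair coins, an output tape and a hash oracle. Programs
never mention the parameters: one program serves all sizes. -/
inductive Prog where
  | skip : Prog
  /-- `r := c` -/
  | const (r c : ℕ) : Prog
  /-- `r := u + v` -/
  | add (r u v : ℕ) : Prog
  /-- `r := u - v` -/
  | sub (r u v : ℕ) : Prog
  /-- `r := mem[u]` -/
  | load (r u : ℕ) : Prog
  /-- `mem[r] := u` -/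
  | store (r u : ℕ) : Prog
  /-- `r :=` the answer of the oracle to hash function number `i` at identifier `x` -/
  | query (r i x : ℕ) : Prog
  /-- `r :=` a fresh random bit -/
  | coin (r : ℕ) : Prog
  /-- append the pair `(u, v)` to the output -/
  | emit (u v : ℕ) : Prog
  | seq (p q : Prog) : Prog
  /-- run `p` if the register `r` is nonzero, else `q` -/
  | ite (r : ℕ) (p q : Prog) : Prog
  /-- run `p` as long as the register `r` is nonzero -/
  | loop (r : ℕ) (p : Prog) : Prog

structure State where
  reg : ℕ → ℕ
  mem : ℕ → ℕ
  /-- the number of coins used so far -/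
  coins : ℕ
  out : List (ℕ × ℕ)

/-- `σ.set r c` is `σ` with the register `r` set to `c`. -/
def State.set (σ : State) (r c : ℕ) : State := { σ with reg := Function.update σ.reg r c }

/-- `Exec O ω p σ τ t`: with the oracle `O` and the coin sequence `ω`, the program `p`, started in
the state `σ`, halts in the state `τ` after exactly `t` steps. Every instruction, every oracle call
and every test of a condition counts as one step. -/
inductive Exec (O : ℕ → ℕ → ℕ) (ω : ℕ → Bool) : Prog → State → State → ℕ → Prop
  | skip (σ : State) : Exec O ω .skip σ σ 1
  | const (σ : State) (r c : ℕ) : Exec O ω (.const r c) σ (σ.set r c) 1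
  | add (σ : State) (r u v : ℕ) : Exec O ω (.add r u v) σ (σ.set r (σ.reg u + σ.reg v)) 1
  | sub (σ : State) (r u v : ℕ) : Exec O ω (.sub r u v) σ (σ.set r (σ.reg u - σ.reg v)) 1
  | load (σ : State) (r u : ℕ) : Exec O ω (.load r u) σ (σ.set r (σ.mem (σ.reg u))) 1
  | store (σ : State) (r u : ℕ) : Exec O ω (.store r u) σ
      { σ with mem := Function.update σ.mem (σ.reg r) (σ.reg u) } 1
  | query (σ : State) (r i x : ℕ) :
      Exec O ω (.query r i x) σ (σ.set r (O (σ.reg i) (σ.reg x))) 1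
  | coin (σ : State) (r : ℕ) : Exec O ω (.coin r) σ
      { σ.set r (ω σ.coins).toNat with coins := σ.coins + 1 } 1
  | emit (σ : State) (u v : ℕ) : Exec O ω (.emit u v) σ
      { σ with out := σ.out ++ [(σ.reg u, σ.reg v)] } 1
  | seq {p q : Prog} {σ τ υ : State} {t t' : ℕ} (hp : Exec O ω p σ τ t) (hq : Exec O ω q τ υ t') :
      Exec O ω (.seq p q) σ υ (t + t')
  | ite_true {r : ℕ} {p q : Prog} {σ τ : State} {t : ℕ} (hr : σ.reg r ≠ 0)
      (hp : Exec O ω p σ τ t) : Exec O ω (.ite r p q) σ τ (t + 1)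
  | ite_false {r : ℕ} {p q : Prog} {σ τ : State} {t : ℕ} (hr : σ.reg r = 0)
      (hq : Exec O ω q σ τ t) : Exec O ω (.ite r p q) σ τ (t + 1)
  | loop_done {r : ℕ} {p : Prog} {σ : State} (hr : σ.reg r = 0) : Exec O ω (.loop r p) σ σ 1
  | loop_step {r : ℕ} {p : Prog} {σ τ υ : State} {t t' : ℕ} (hr : σ.reg r ≠ 0)
      (hp : Exec O ω p σ τ t) (hl : Exec O ω (.loop r p) τ υ t') :
      Exec O ω (.loop r p) σ υ (t + t' + 1)

/-- The hash oracle. Hash functions are numbered `0, …, k - 1`, the entries of a sub-table are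
numbered `1, …, m` in the answers, and `0` answers a query outside the range. -/
noncomputable def oracle {P : Params} {N : ℕ∞} (H : HashFns P N) (i x : ℕ) : ℕ :=
  open Classical in
  if h : i < P.k ∧ (x : ℕ∞) < N then (H (⟨i, h.1⟩, ⟨x, h.2⟩) : ℕ) + 1 else 0

/-- The initial state: the registers `0, …, 5` hold `n, lam, k, b, ℓ, s`; all else is zero. -/
def initState (n lam : ℕ) (P : Params) : State where
  reg r := [n, lam, P.k, P.b, P.ℓ, P.s].getD r 0
  mem _ := 0
  coins := 0
  out := []

/-- `A` halts within `Q` steps, whatever the hash functions and the coins are. -/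
def RunsWithin (A : Prog) (n lam : ℕ) (P : Params) (N : ℕ∞) (Q : ℕ) : Prop :=
  ∀ (H : HashFns P N) (ω : ℕ → Bool), ∃ τ t,
    Exec (oracle H) ω A (initState n lam P) τ t ∧ t ≤ Q

/-- `A` outputs `n` items with distinct identifiers for which the construction fails. -/
def Wins (A : Prog) (n lam : ℕ) (P : Params) (N V : ℕ∞) (H : HashFns P N) (ω : ℕ → Bool) : Prop :=
  ∃ τ t, Exec (oracle H) ω A (initState n lam P) τ t ∧
    ∃ (x : Fin n → Universe N) (v : Fin n → Universe V), Function.Injective x ∧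
      τ.out = List.ofFn (fun j => ((x j : ℕ), (v j : ℕ))) ∧
      construct H (Set.range fun j => (x j, v j)) = none

/-- The law of an infinite sequence of independent fair coins. -/
noncomputable def coinLaw : Measure (ℕ → Bool) :=
  Measure.infinitePi fun _ => (PMF.uniformOfFintype Bool).toMeasure

/-- The probability, over random hash functions and coins, that `A` makes the construction fail. -/
noncomputable def winProb (A : Prog) (n lam : ℕ) (P : Params) (N V : ℕ∞) : ENNReal :=
  ((hashLaw P N).prod coinLaw) {p | Wins A n lam P N V p.1 p.2}

/-! ### Robustness

A family of schemes is indexed by `t : ℕ`: scheme number `t` stores `n t` items at the security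
parameter `lam t`, with the parameters `P t` and with universes of sizes `N t` and `V t`. -/

/-- `(Q, ε)`-robustness: every adversary with running time `O(Q)` makes the construction fail with
probability at most `ε`, for all large indices. -/
def Robust (n lam : ℕ → ℕ) (P : ℕ → Params) (N V : ℕ → ℕ∞) (Q : ℕ → ℕ) (ε : ENNReal) : Prop :=
  ∀ A : Prog, (∃ C : ℕ, ∀ t, RunsWithin A (n t) (lam t) (P t) (N t) (C * Q t)) →
    ∀ᶠ t in atTop, winProb A (n t) (lam t) (P t) (N t) (V t) ≤ ε

/-- Robustness with error `ε` against all adversaries that run in time polynomial in `n` and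
`lam`. -/
def PolyRobust (n lam : ℕ → ℕ) (P : ℕ → Params) (N V : ℕ → ℕ∞) (ε : ENNReal) : Prop :=
  ∀ q : MvPolynomial (Fin 2) ℕ,
    Robust n lam P N V (fun t => MvPolynomial.eval ![n t, lam t] q) ε

end Cuckoo

/-! The adversary crowds items into few entries. Let `q` be maximal with `s + q * k * ℓ < n`. Items
whose `k` hash values are all at most `q` compete for only `s + q * k * ℓ` locations, so `n` of them
cannot be stored (`construct_eq_none`). Such identifiers are not rare. The query overhead bound
gives `q ≥ 1`; with `s ≤ n / 2` and `b = O(n / ℓ)`, the first `q` entries are a constant fraction `1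
/ D` of a sub-table (`m_le_mul_threshold`). An identifier is thus small with probability at least `D
^ (-k)`. If `k = ω(log λ)` fails, this is at least `λ ^ (-a)` for infinitely many indices, with `a`
constant. Scanning `n` disjoint blocks of `4 * n * λ ^ a` identifiers then finds one in every block
except with probability `1 / 4` (`hashLaw_compl_blockSet_le`). At most `λ ^ (a + 3)` identifiers are
needed, so the attack is polynomial and beats `1 / 2`. -/

namespace Cuckoo

/-! ### Running time and final states of programs -/

/-- `p` leads from `σ` to `τ` in at most `B` steps. -/
def Reach (O : ℕ → ℕ → ℕ) (ω : ℕ → Bool) (p : Prog) (σ τ : State) (B : ℕ) : Prop :=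
  ∃ t, Exec O ω p σ τ t ∧ t ≤ B

section Reach

variable {O : ℕ → ℕ → ℕ} {ω : ℕ → Bool} {p q : Prog} {σ τ υ : State} {A B : ℕ}

theorem Exec.reach {t : ℕ} (h : Exec O ω p σ τ t) : Reach O ω p σ τ t := ⟨t, h, le_rfl⟩

theorem Reach.mono (h : Reach O ω p σ τ A) (hAB : A ≤ B) : Reach O ω p σ τ B :=
  let ⟨t, ht, hA⟩ := h
  ⟨t, ht, hA.trans hAB⟩

theorem Reach.seq (hp : Reach O ω p σ τ A) (hq : Reach O ω q τ υ B) :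
    Reach O ω (.seq p q) σ υ (A + B) :=
  let ⟨_, hp, hA⟩ := hp
  let ⟨_, hq, hB⟩ := hq
  ⟨_, .seq hp hq, Nat.add_le_add hA hB⟩

theorem Reach.ite_true {r : ℕ} (hr : σ.reg r ≠ 0) (hp : Reach O ω p σ τ A) :
    Reach O ω (.ite r p q) σ τ (A + 1) :=
  let ⟨_, hp, hA⟩ := hp
  ⟨_, .ite_true hr hp, Nat.add_le_add_right hA 1⟩

theorem Reach.ite_false {r : ℕ} (hr : σ.reg r = 0) (hq : Reach O ω q σ τ A) :
    Reach O ω (.ite r p q) σ τ (A + 1) :=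
  let ⟨_, hq, hA⟩ := hq
  ⟨_, .ite_false hr hq, Nat.add_le_add_right hA 1⟩

theorem Reach.loop_step {r : ℕ} (hr : σ.reg r ≠ 0) (hp : Reach O ω p σ τ A)
    (hl : Reach O ω (.loop r p) τ υ B) : Reach O ω (.loop r p) σ υ (A + B + 1) :=
  let ⟨_, hp, hA⟩ := hp
  let ⟨_, hl, hB⟩ := hl
  ⟨_, .loop_step hr hp hl, by omega⟩

end Reach

/-- The state with the given register contents and output, and with an empty memory. -/
def ofList (L : List ℕ) (out : List (ℕ × ℕ)) : State where
  reg r := L.getD r 0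
  mem _ := 0
  coins := 0
  out := out

@[simp] theorem ofList_reg (L : List ℕ) (out : List (ℕ × ℕ)) (r : ℕ) :
    (ofList L out).reg r = L.getD r 0 := rfl

@[simp] theorem ofList_out (L : List ℕ) (out : List (ℕ × ℕ)) : (ofList L out).out = out := rfl

/-- `List.set` does nothing past the end of the list, hence the length condition. -/
theorem ofList_set {L : List ℕ} {out : List (ℕ × ℕ)} {r : ℕ} (c : ℕ) (hr : r < L.length) :
    (ofList L out).set r c = ofList (L.set r c) out := by
  simp only [State.set, ofList, State.mk.injEq, and_true]
  funext i
  rcases eq_or_ne i r with rfl | hi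
  · simp [hr]
  · simp [Function.update_of_ne hi, List.getD_eq_getElem?_getD, List.getElem?_set_ne hi.symm]

/-- The padding with zeros makes all registers of the attack, numbers `0` to `13`, list positions
that can be overwritten. -/
theorem initState_eq (n lam : ℕ) (P : Params) :
    initState n lam P =
      ofList [n, lam, P.k, P.b, P.ℓ, P.s, 0, 0, 0, 0, 0, 0, 0, 0] [] := by
  simp only [initState, ofList, State.mk.injEq, and_true]
  funext r
  rcases lt_or_ge r 14 with h | h
  · interval_cases r <;> rfl
  · rw [List.getD_eq_default _ _ (by simp; omega), List.getD_eq_default _ _ (by simpa using h)]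

section Instructions

variable {O : ℕ → ℕ → ℕ} {ω : ℕ → Bool} {L L' : List ℕ} {out : List (ℕ × ℕ)}

/-- Here and below, the equation `h` lets the resulting list be written out explicitly and checked
by `rfl`. -/
theorem reach_const {r c : ℕ} (hr : r < L.length) (h : L.set r c = L') :
    Reach O ω (.const r c) (ofList L out) (ofList L' out) 1 := by
  rw [← h, ← ofList_set _ hr]; exact (Exec.const ..).reach

theorem reach_add {r u v : ℕ} (hr : r < L.length)
    (h : L.set r (L.getD u 0 + L.getD v 0) = L') :
    Reach O ω (.add r u v) (ofList L out) (ofList L' out) 1 := by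
  rw [← h, ← ofList_set _ hr]; exact (Exec.add ..).reach

theorem reach_sub {r u v : ℕ} (hr : r < L.length)
    (h : L.set r (L.getD u 0 - L.getD v 0) = L') :
    Reach O ω (.sub r u v) (ofList L out) (ofList L' out) 1 := by
  rw [← h, ← ofList_set _ hr]; exact (Exec.sub ..).reach

theorem reach_query {r i x : ℕ} (hr : r < L.length)
    (h : L.set r (O (L.getD i 0) (L.getD x 0)) = L') :
    Reach O ω (.query r i x) (ofList L out) (ofList L' out) 1 := by
  rw [← h, ← ofList_set _ hr]; exact (Exec.query ..).reach

theorem reach_emit {u v : ℕ} :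
    Reach O ω (.emit u v) (ofList L out) (ofList L (out ++ [(L.getD u 0, L.getD v 0)])) 1 :=
  (Exec.emit ..).reach

end Instructions

/-! ### The adversary

Registers: `0` number of items still to be output, `1` security parameter, `2` number of hash
functions, `3` zero, `4` entry size, `5` stash size, `6` one, `7` slots per row of entries,
`8` loop counter, `9` threshold, `10` scratch, `11` number of identifiers still to be examined,
`12` accumulator, `13` current identifier. -/

/-- Multiplication of `u` by `v`, added to the register `r`. -/
def mulProg (r u v : ℕ) : Prog :=
  .seq (.add 8 u 3) (.loop 8 (.seq (.add r r v) (.sub 8 8 6)))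

/-- Computation of the largest threshold for which the admissible slots cannot hold all items. -/
def thresholdProg : Prog :=
  .seq (.sub 10 0 5) (.seq (.sub 10 10 7) (.loop 10 (.seq (.add 9 9 6) (.sub 10 10 7))))

/-- Computation of the `d`-th power of the security parameter. -/
def powProg : ℕ → Prog
  | 0 => .const 11 1
  | d + 1 => .seq (powProg d) (.seq (.const 12 0) (.seq (mulProg 12 1 11) (.add 11 12 3)))

/-- Sum of the amounts by which the hash values of the current identifier exceed the threshold. -/
def excessProg : Prog :=
  .seq (.const 12 0) (.seq (.add 8 2 3)
    (.loop 8 (.seq (.sub 8 8 6) (.seq (.query 10 8 13) (.seq (.sub 10 10 9) (.add 12 12 10))))))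

/-- Output of the current identifier if it has no excess and items are still missing. -/
def selectProg : Prog :=
  .ite 12 .skip (.ite 0 (.seq (.emit 13 3) (.sub 0 0 6)) .skip)

def searchProg : Prog :=
  .loop 11 (.seq excessProg (.seq selectProg (.seq (.add 13 13 6) (.sub 11 11 6))))

/-- Among the first `lam ^ d` identifiers, output those all of whose hash values are at most the
threshold, up to `n` of them. -/
def attack (d : ℕ) : Prog :=
  .seq (.const 3 0) (.seq (.const 6 1) (.seq (mulProg 7 2 4)
    (.seq thresholdProg (.seq (powProg d) searchProg))))

/-- The total excess of the `k` hash values of `x` over `q`. -/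
def excess (O : ℕ → ℕ → ℕ) (k q x : ℕ) : ℕ := ∑ i ∈ Finset.range k, (O i x - q)

/-- The first `n` identifiers below `T` without excess. -/
def selection (O : ℕ → ℕ → ℕ) (k q T n : ℕ) : List ℕ :=
  ((List.range T).filter fun x => excess O k q x = 0).take n

/-! ### Correctness and running time of the attack program -/

section Exec

variable {O : ℕ → ℕ → ℕ} {ω : ℕ → Bool} {n lam k l s kl c q e T a x : ℕ}
  {out : List (ℕ × ℕ)}

theorem reach_mul_loop_row (j : ℕ) :
    Reach O ω (.loop 8 (.seq (.add 7 7 4) (.sub 8 8 6)))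
      (ofList [n, lam, k, 0, l, s, 1, kl, j, q, e, T, a, x] out)
      (ofList [n, lam, k, 0, l, s, 1, kl + j * l, 0, q, e, T, a, x] out) (3 * j + 1) := by
  induction j generalizing kl with
  | zero => simpa using (Exec.loop_done (by simp)).reach
  | succ j ih =>
    rw [show kl + (j + 1) * l = kl + l + j * l by ring]
    exact (Reach.loop_step (by simp) (.seq (reach_add (by simp) rfl) (reach_sub (by simp) rfl))
      ih).mono (by omega)

theorem reach_mul_row :
    Reach O ω (mulProg 7 2 4)
      (ofList [n, lam, k, 0, l, s, 1, 0, c, q, e, T, a, x] out)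
      (ofList [n, lam, k, 0, l, s, 1, k * l, 0, q, e, T, a, x] out) (3 * k + 2) := by
  have h := reach_mul_loop_row (O := O) (ω := ω) (n := n) (lam := lam) (k := k) (l := l) (s := s)
    (kl := 0) (q := q) (e := e) (T := T) (a := a) (x := x) (out := out) k
  rw [zero_add] at h
  exact ((reach_add (by simp) rfl).seq h).mono (by omega)

theorem reach_mul_loop_pow (j : ℕ) :
    Reach O ω (.loop 8 (.seq (.add 12 12 11) (.sub 8 8 6)))
      (ofList [n, lam, k, 0, l, s, 1, kl, j, q, e, T, a, x] out)
      (ofList [n, lam, k, 0, l, s, 1, kl, 0, q, e, T, a + j * T, x] out) (3 * j + 1) := by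
  induction j generalizing a with
  | zero => simpa using (Exec.loop_done (by simp)).reach
  | succ j ih =>
    rw [show a + (j + 1) * T = a + T + j * T by ring]
    exact (Reach.loop_step (by simp) (.seq (reach_add (by simp) rfl) (reach_sub (by simp) rfl))
      ih).mono (by omega)

theorem reach_mul_pow :
    Reach O ω (mulProg 12 1 11)
      (ofList [n, lam, k, 0, l, s, 1, kl, c, q, e, T, 0, x] out)
      (ofList [n, lam, k, 0, l, s, 1, kl, 0, q, e, T, lam * T, x] out) (3 * lam + 2) := by
  have h := reach_mul_loop_pow (O := O) (ω := ω) (n := n) (lam := lam) (k := k) (l := l) (s := s)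
    (kl := kl) (q := q) (e := e) (T := T) (a := 0) (x := x) (out := out) lam
  rw [zero_add] at h
  exact ((reach_add (by simp) rfl).seq h).mono (by omega)

theorem reach_pow (d : ℕ) : ∃ a', Reach O ω (powProg d)
    (ofList [n, lam, k, 0, l, s, 1, kl, 0, q, e, T, a, x] out)
    (ofList [n, lam, k, 0, l, s, 1, kl, 0, q, e, lam ^ d, a', x] out)
    (d * (3 * lam + 4) + 1) := by
  induction d with
  | zero => exact ⟨a, (reach_const (by simp) (by simp)).mono (by omega)⟩
  | succ d ih =>
    obtain ⟨a', ih⟩ := ih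
    refine ⟨lam ^ (d + 1), ?_⟩
    have h := ih.seq (.seq (reach_const (r := 12) (c := 0) (by simp) rfl)
      (.seq reach_mul_pow (reach_add (r := 11) (u := 12) (v := 3) (by simp) rfl)))
    rw [pow_succ']
    exact h.mono (le_of_eq (by ring))

/-- Register `10` holds the truncated difference `n - s - (q + 1) * kl`, which is nonzero exactly
when `q` may still grow. The number `j` bounds the remaining rounds. The value `q'` is fixed before
the oracle and the coins. -/
theorem reach_threshold_loop (hkl : 1 ≤ kl) (j : ℕ) (hj : n ≤ s + (q + 1) * kl + j)
    (hq : q = 0 ∨ s + q * kl < n) :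
    ∃ q', (q' = 0 ∨ s + q' * kl < n) ∧ n ≤ s + (q' + 1) * kl ∧
      ∀ (O : ℕ → ℕ → ℕ) (ω : ℕ → Bool),
        Reach O ω (.loop 10 (.seq (.add 9 9 6) (.sub 10 10 7)))
          (ofList [n, lam, k, 0, l, s, 1, kl, c, q, n - s - (q + 1) * kl, T, a, x] out)
          (ofList [n, lam, k, 0, l, s, 1, kl, c, q', 0, T, a, x] out) (3 * j + 1) := by
  induction j generalizing q with
  | zero =>
    refine ⟨q, hq, hj, fun O ω => ?_⟩
    rw [show n - s - (q + 1) * kl = 0 by omega]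
    exact (Exec.loop_done (by simp)).reach
  | succ j ih =>
    by_cases h : n ≤ s + (q + 1) * kl
    · refine ⟨q, hq, h, fun O ω => ?_⟩
      rw [show n - s - (q + 1) * kl = 0 by omega]
      exact (Exec.loop_done (by simp)).reach.mono (by omega)
    · have hs : (q + 1 + 1) * kl = (q + 1) * kl + kl := by ring
      obtain ⟨q', h₁, h₂, h₃⟩ := ih (q := q + 1) (by omega) (.inr (by omega))
      refine ⟨q', h₁, h₂, fun O ω => ?_⟩
      have h := h₃ O ω
      rw [hs, ← Nat.sub_sub] at h
      refine (Reach.loop_step ?_ (.seq (reach_add (by simp) rfl) (reach_sub (by simp) rfl))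
        h).mono (by omega)
      simp
      omega

theorem reach_threshold (hkl : 1 ≤ kl) :
    ∃ q, (q = 0 ∨ s + q * kl < n) ∧ n ≤ s + (q + 1) * kl ∧
      ∀ (O : ℕ → ℕ → ℕ) (ω : ℕ → Bool),
        Reach O ω thresholdProg
          (ofList [n, lam, k, 0, l, s, 1, kl, c, 0, e, T, a, x] out)
          (ofList [n, lam, k, 0, l, s, 1, kl, c, q, 0, T, a, x] out) (3 * n + 3) := by
  obtain ⟨q, h₁, h₂, h₃⟩ := reach_threshold_loop (n := n) (lam := lam) (k := k) (l := l) (s := s)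
    (c := c) (q := 0) (T := T) (a := a) (x := x) (out := out) hkl n (by omega) (.inl rfl)
  refine ⟨q, h₁, h₂, fun O ω => ?_⟩
  have h := h₃ O ω
  rw [zero_add, one_mul] at h
  exact ((reach_sub (by simp) rfl).seq ((reach_sub (by simp) rfl).seq h)).mono (by omega)

/-- The counter is lowered before the query, so the queried indices are `j - 1, …, 0`. Truncated
terms cannot cancel: the sum vanishes only if every answer is at most `q`. -/
theorem reach_excess_loop (j : ℕ) : ∃ e', Reach O ω
    (.loop 8 (.seq (.sub 8 8 6) (.seq (.query 10 8 13) (.seq (.sub 10 10 9) (.add 12 12 10)))))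
    (ofList [n, lam, k, 0, l, s, 1, kl, j, q, e, T, a, x] out)
    (ofList [n, lam, k, 0, l, s, 1, kl, 0, q, e', T, a + excess O j q x, x] out)
    (5 * j + 1) := by
  induction j generalizing a e with
  | zero => exact ⟨e, by simpa [excess] using (Exec.loop_done (by simp)).reach⟩
  | succ j ih =>
    obtain ⟨e', h⟩ := ih (a := a + (O j x - q)) (e := O j x - q)
    refine ⟨e', ?_⟩
    rw [show a + excess O (j + 1) q x = a + (O j x - q) + excess O j q x by
      rw [excess, Finset.sum_range_succ, excess]; ring]
    exact (Reach.loop_step (by simp) (.seq (reach_sub (by simp) rfl) (.seq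
      (reach_query (by simp) rfl) (.seq (reach_sub (by simp) rfl) (reach_add (by simp) rfl))))
      h).mono (by omega)

theorem reach_excess : ∃ e', Reach O ω excessProg
    (ofList [n, lam, k, 0, l, s, 1, kl, c, q, e, T, a, x] out)
    (ofList [n, lam, k, 0, l, s, 1, kl, 0, q, e', T, excess O k q x, x] out)
    (5 * k + 3) := by
  obtain ⟨e', h⟩ := reach_excess_loop (O := O) (ω := ω) (n := n) (lam := lam) (k := k) (l := l)
    (s := s) (kl := kl) (q := q) (e := e) (T := T) (a := 0) (x := x) (out := out) k
  rw [zero_add] at h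
  exact ⟨e', ((reach_const (by simp) rfl).seq ((reach_add (by simp) rfl).seq h)).mono (by omega)⟩

theorem reach_select : Reach O ω selectProg
    (ofList [n, lam, k, 0, l, s, 1, kl, c, q, e, T, a, x] out)
    (ofList [if a = 0 then n - 1 else n, lam, k, 0, l, s, 1, kl, c, q, e, T, a, x]
      (out ++ if a = 0 ∧ n ≠ 0 then [(x, 0)] else [])) 4 := by
  by_cases ha : a = 0
  · subst ha
    by_cases hn : n = 0
    · subst hn
      simp only [if_true, ne_eq, not_true_eq_false, and_false, if_false, List.append_nil]
      exact (Reach.ite_false (by simp) (.ite_false (by simp) (Exec.skip _).reach)).mono (by omega)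
    · simp only [if_true, ne_eq, hn, not_false_eq_true, and_self]
      exact (Reach.ite_false (by simp) (.ite_true (by simpa using hn)
        (.seq reach_emit (reach_sub (by simp) rfl)))).mono (by omega)
  · simp only [ha, false_and, if_false, List.append_nil]
    exact (Reach.ite_true (by simpa using ha) (Exec.skip _).reach).mono (by omega)

/-- An identifier costs `5 * k + 3` steps for its excess, `4` for the selection, `2` for the
counters and `1` for the loop test. -/
theorem reach_search (T : ℕ) : ∃ τ, Reach O ω searchProg
    (ofList [n, lam, k, 0, l, s, 1, kl, c, q, e, T, a, x] out) τ (T * (5 * k + 10) + 1) ∧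
    τ.out = out ++ (((List.range' x T).filter fun y => excess O k q y = 0).take n).map
      fun y => (y, 0) := by
  induction T generalizing n c e a x out with
  | zero => exact ⟨_, (Exec.loop_done (by simp)).reach.mono (by omega), by simp⟩
  | succ T ih =>
    obtain ⟨e', h⟩ := reach_excess (O := O) (ω := ω) (n := n) (lam := lam) (k := k) (l := l)
      (s := s) (kl := kl) (c := c) (q := q) (e := e) (T := T + 1) (a := a) (x := x) (out := out)
    obtain ⟨τ, h₁, h₂⟩ := ih (n := if excess O k q x = 0 then n - 1 else n) (c := 0) (e := e')
      (a := excess O k q x) (x := x + 1)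
      (out := out ++ if excess O k q x = 0 ∧ n ≠ 0 then [(x, 0)] else [])
    refine ⟨τ, (Reach.loop_step (by simp) (h.seq (reach_select.seq (.seq (reach_add (by simp) rfl)
      (reach_sub (by simp) rfl)))) h₁).mono (le_of_eq (by ring)), ?_⟩
    rw [h₂, List.range'_succ]
    by_cases hx : excess O k q x = 0
    · cases n <;> simp [hx]
    · simp [hx]

/-- An upper bound on the running time of the adversary. -/
def attackTime (d n lam k : ℕ) : ℕ :=
  lam ^ d * (5 * k + 10) + d * (3 * lam + 4) + 3 * n + 3 * k + 9

/-- The threshold depends on the parameters alone, so the probability of a small identifier can be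
computed for a fixed `q`. -/
theorem attack_spec (d n lam : ℕ) (P : Params) :
    ∃ q, (q = 0 ∨ P.s + q * (P.k * P.ℓ) < n) ∧ n ≤ P.s + (q + 1) * (P.k * P.ℓ) ∧
      ∀ (O : ℕ → ℕ → ℕ) (ω : ℕ → Bool), ∃ τ,
        Reach O ω (attack d) (initState n lam P) τ (attackTime d n lam P.k) ∧
        τ.out = (selection O P.k q (lam ^ d) n).map fun y => (y, 0) := by
  obtain ⟨q, h₁, h₂, h₃⟩ := reach_threshold (n := n) (lam := lam) (k := P.k) (l := P.ℓ) (s := P.s)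
    (kl := P.k * P.ℓ) (c := 0) (e := 0) (T := 0) (a := 0) (x := 0) (out := [])
    (Nat.mul_pos P.k_pos P.ℓ_pos)
  refine ⟨q, h₁, h₂, fun O ω => ?_⟩
  obtain ⟨a, hp⟩ := reach_pow (O := O) (ω := ω) (n := n) (lam := lam) (k := P.k) (l := P.ℓ)
    (s := P.s) (kl := P.k * P.ℓ) (q := q) (e := 0) (T := 0) (a := 0) (x := 0) (out := []) d
  obtain ⟨τ, hτ, hout⟩ := reach_search (O := O) (ω := ω) (n := n) (lam := lam) (k := P.k)
    (l := P.ℓ) (s := P.s) (kl := P.k * P.ℓ) (c := 0) (q := q) (e := 0) (a := a) (x := 0)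
    (out := []) (lam ^ d)
  refine ⟨τ, ?_, by simpa [selection, List.range_eq_range'] using hout⟩
  rw [initState_eq]
  refine (Reach.seq (reach_const (by simp) rfl) (.seq (reach_const (by simp) rfl)
    (.seq reach_mul_row (.seq (h₃ O ω) (hp.seq hτ))))).mono (le_of_eq ?_)
  rw [attackTime]
  ring

end Exec
/-! ### Identifiers whose hash values are all small -/

/-- The hash functions that send `x` to one of the first `q` entries of every sub-table. -/
def smallSet (P : Params) (N : ℕ∞) (q : ℕ) (x : Universe N) : Set (HashFns P N) :=
  {H | ∀ i, (H (i, x) : ℕ) < q}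

theorem excess_oracle_eq_zero {P : Params} {N : ℕ∞} (H : HashFns P N) (q : ℕ) (x : Universe N) :
    excess (oracle H) P.k q x = 0 ↔ H ∈ smallSet P N q x := by
  simp only [excess, Finset.sum_eq_zero_iff, Finset.mem_range, smallSet, Set.mem_ofPred_eq]
  -- Oracle answers number the entries from `1`: an answer at most `q` is a zero-based entry below
  -- `q`.
  have h (i : Fin P.k) : oracle H i x - q = 0 ↔ (H (i, x) : ℕ) < q := by
    rw [oracle, dif_pos ⟨i.2, x.2⟩]
    change (H (i, x) : ℕ) + 1 - q = 0 ↔ _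
    omega
  exact ⟨fun H' i => (h i).1 (H' i i.2), fun H' i hi => (h ⟨i, hi⟩).2 (H' ⟨i, hi⟩)⟩

instance (P : Params) (N : ℕ∞) : IsProbabilityMeasure (hashLaw P N) := by
  unfold hashLaw; infer_instance

instance : IsProbabilityMeasure coinLaw := by
  unfold coinLaw; infer_instance

/-- The probability that a uniformly random entry of a sub-table is among the first `q`. -/
noncomputable def smallProb (P : Params) (q : ℕ) : ENNReal :=
  (PMF.uniformOfFintype (Fin P.m)).toMeasure {e | (e : ℕ) < q}

/-- A box over finitely many coordinates has an explicit product measure; independence across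
identifiers follows from it. -/
theorem biInter_smallSet (P : Params) (N : ℕ∞) (q : ℕ) (S : Finset (Universe N)) :
    ⋂ x ∈ S, smallSet P N q x =
      Set.pi (Finset.univ ×ˢ S : Finset (Fin P.k × Universe N))
        fun _ => {e : Fin P.m | (e : ℕ) < q} := by
  ext H
  simp only [smallSet, Set.mem_iInter, Set.mem_ofPred_eq, Set.mem_pi, Finset.mem_coe,
    Finset.mem_product, Finset.mem_univ, true_and, Prod.forall]
  exact ⟨fun h i x hx => h x hx i, fun h x hx i => h i x hx⟩

theorem hashLaw_biInter_smallSet (P : Params) (N : ℕ∞) (q : ℕ) (S : Finset (Universe N)) :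
    hashLaw P N (⋂ x ∈ S, smallSet P N q x) = (smallProb P q ^ P.k) ^ S.card := by
  rw [biInter_smallSet, hashLaw, Measure.infinitePi_pi _ (fun _ _ => MeasurableSet.of_discrete)]
  simp [Finset.prod_const, smallProb, pow_mul]

theorem hashLaw_smallSet (P : Params) (N : ℕ∞) (q : ℕ) (x : Universe N) :
    hashLaw P N (smallSet P N q x) = smallProb P q ^ P.k := by
  simpa using hashLaw_biInter_smallSet P N q {x}

theorem measurableSet_smallSet (P : Params) (N : ℕ∞) (q : ℕ) (x : Universe N) :
    MeasurableSet (smallSet P N q x) := by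
  have h := biInter_smallSet P N q {x}
  rw [Finset.set_biInter_singleton] at h
  rw [h]
  exact .pi (Finset.countable_toSet _) fun _ _ => MeasurableSet.of_discrete

theorem iIndepSet_smallSet (P : Params) (N : ℕ∞) (q : ℕ) :
    ProbabilityTheory.iIndepSet (smallSet P N q) (hashLaw P N) := by
  rw [ProbabilityTheory.iIndepSet_iff_meas_biInter (measurableSet_smallSet P N q)]
  intro S
  rw [hashLaw_biInter_smallSet]
  simp [hashLaw_smallSet]

theorem hashLaw_biInter_compl_smallSet (P : Params) (N : ℕ∞) (q : ℕ) (S : Finset (Universe N)) :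
    hashLaw P N (⋂ x ∈ S, (smallSet P N q x)ᶜ) = (1 - smallProb P q ^ P.k) ^ S.card := by
  rw [((ProbabilityTheory.iIndepSet_iff_iIndep _ _).1 (iIndepSet_smallSet P N q)).meas_biInter
    fun x _ => (MeasurableSpace.measurableSet_generateFrom
      (Set.mem_singleton (smallSet P N q x))).compl]
  simp [prob_compl_eq_one_sub (measurableSet_smallSet P N q _), hashLaw_smallSet]

/-- An identifier is small with probability at least `M⁻¹` if the threshold is at least a `D`-th
part of the sub-table and `D ^ k ≤ M`. -/
theorem inv_le_smallProb_pow (P : Params) {q D M : ℕ} (hD : 1 ≤ D) (hq : P.m ≤ D * q)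
    (hM : D ^ P.k ≤ M) : (M : ENNReal)⁻¹ ≤ smallProb P q ^ P.k := by
  have h : (D : ENNReal)⁻¹ ≤ smallProb P q := by
    have hm : (P.m : ENNReal) ≠ 0 := by exact_mod_cast NeZero.ne P.m
    rw [smallProb, PMF.toMeasure_uniformOfFintype_apply _ MeasurableSet.of_discrete]
    have hcard : Fintype.card {e : Fin P.m | (e : ℕ) < q} = min q P.m := by
      calc _ = Fintype.card {e : Fin P.m // (e : ℕ) < q} := Fintype.card_congr (Equiv.refl _)
        _ = min q P.m := by
          rw [Fintype.card_subtype, Fin.card_filter_val_lt, min_comm]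
    rw [hcard, Fintype.card_fin, ENNReal.le_div_iff_mul_le (.inl hm) (.inl (by simp)), mul_comm,
      ← div_eq_mul_inv]
    refine ENNReal.div_le_of_le_mul ?_
    norm_cast
    -- For `q ≥ m` the probability is `1`, and `1 ≤ D` suffices.
    rcases le_total q P.m with h | h
    · simpa [h, mul_comm] using hq
    · simpa [h] using Nat.le_mul_of_pos_right P.m hD
  calc (M : ENNReal)⁻¹ ≤ ((D : ENNReal) ^ P.k)⁻¹ := by
        rw [ENNReal.inv_le_inv]; exact_mod_cast hM
    _ = (D : ENNReal)⁻¹ ^ P.k := ENNReal.inv_pow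
    _ ≤ _ := by gcongr

/-- `B` identifiers are all not small with probability at most `(4 * n)⁻¹`. -/
theorem one_sub_pow_le {ρ : ENNReal} {M n : ℕ} (hn : 1 ≤ n) (hM : 1 ≤ M)
    (hρ : (M : ENNReal)⁻¹ ≤ ρ) : (1 - ρ) ^ (4 * n * M) ≤ (4 * n : ENNReal)⁻¹ := by
  have hM' : (1 : ℝ) ≤ M := by exact_mod_cast hM
  have hn' : (1 : ℝ) ≤ n := by exact_mod_cast hn
  have h₁ : (M : ℝ)⁻¹ ≤ 1 := inv_le_one_of_one_le₀ hM'
  have h₀ : (0 : ℝ) < (M : ℝ)⁻¹ := by positivity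
  have key : (1 - (M : ℝ)⁻¹) ^ (4 * n * M) ≤ (4 * n : ℝ)⁻¹ := by
    -- Bernoulli bounds `(1 + 1/M) ^ (4nM)` below by `1 + 4n`, and its product with `(1 - 1/M) ^
    -- (4nM)` is at most `1`.
    have hb := one_add_mul_le_pow (a := (M : ℝ)⁻¹) (by linarith) (4 * n * M)
    push_cast at hb
    rw [mul_assoc (4 * (n : ℝ)), mul_inv_cancel₀ (by positivity), mul_one] at hb
    have hc : (1 - (M : ℝ)⁻¹) ^ (4 * n * M) * (1 + (M : ℝ)⁻¹) ^ (4 * n * M) ≤ 1 := by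
      rw [← mul_pow]
      refine pow_le_one₀ (mul_nonneg (by linarith) (by linarith)) (by nlinarith)
    rw [← one_div (4 * n : ℝ), le_div_iff₀ (by positivity)]
    exact (mul_le_mul_of_nonneg_left (by linarith) (pow_nonneg (by linarith) _)).trans hc
  calc (1 - ρ) ^ (4 * n * M) ≤ (1 - (M : ENNReal)⁻¹) ^ (4 * n * M) := by gcongr
    _ = ENNReal.ofReal ((1 - (M : ℝ)⁻¹) ^ (4 * n * M)) := by
        rw [ENNReal.ofReal_pow (by linarith), ENNReal.ofReal_sub _ h₀.le,
          ENNReal.ofReal_inv_of_pos (by positivity)]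
        simp
    _ ≤ ENNReal.ofReal (4 * n : ℝ)⁻¹ := ENNReal.ofReal_le_ofReal key
    _ = (4 * n : ENNReal)⁻¹ := by
        rw [ENNReal.ofReal_inv_of_pos (by positivity), ENNReal.ofReal_mul (by norm_num)]
        simp

/-- Every one of `n` consecutive blocks of `B` identifiers has a small one. -/
def blockSet (P : Params) (N : ℕ∞) (q n B : ℕ) : Set (HashFns P N) :=
  {H | ∀ j < n, ∃ i < B, excess (oracle H) P.k q (j * B + i) = 0}

/-- A union bound over `n` blocks, each of which fails with probability at most `1 / (4n)`. -/
theorem hashLaw_compl_blockSet_le (P : Params) (N : ℕ∞) {q n M : ℕ} (hn : 1 ≤ n) (hM : 1 ≤ M)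
    (hρ : (M : ENNReal)⁻¹ ≤ smallProb P q ^ P.k) (hN : ((n * (4 * n * M) : ℕ) : ℕ∞) ≤ N) :
    hashLaw P N (blockSet P N q n (4 * n * M))ᶜ ≤ 4⁻¹ := by
  set B := 4 * n * M with hB
  have hlt (j : ℕ) (hj : j < n) (i : ℕ) (hi : i < B) : ((j * B + i : ℕ) : ℕ∞) < N := by
    refine lt_of_lt_of_le ?_ hN
    have : (j + 1) * B ≤ n * B := Nat.mul_le_mul_right B hj
    rw [add_mul] at this
    exact_mod_cast (by omega)
  have hblock (j : Fin n) : hashLaw P N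
      {H | ∀ i < B, excess (oracle H) P.k q (j * B + i) ≠ 0} ≤ (4 * n : ENNReal)⁻¹ := by
    let g : Fin B ↪ Universe N :=
      ⟨fun i => ⟨j * B + i, hlt j j.2 i i.2⟩, fun i i' h => by
        have := congrArg Subtype.val h
        ext; simpa using this⟩
    refine (measure_mono (t := ⋂ x ∈ Finset.univ.map g, (smallSet P N q x)ᶜ) ?_).trans ?_
    · intro H hH
      simp only [Finset.mem_map, Finset.mem_univ, true_and, Set.mem_iInter]
      rintro _ ⟨i, rfl⟩
      exact fun h => hH i i.2 ((excess_oracle_eq_zero H q (g i)).2 h)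
    · rw [hashLaw_biInter_compl_smallSet, Finset.card_map, Finset.card_univ, Fintype.card_fin]
      exact one_sub_pow_le hn hM hρ
  calc hashLaw P N (blockSet P N q n B)ᶜ
      ≤ hashLaw P N (⋃ j : Fin n, {H | ∀ i < B, excess (oracle H) P.k q (j * B + i) ≠ 0}) := by
        refine measure_mono fun H hH => ?_
        simp only [blockSet, Set.mem_compl_iff, Set.mem_ofPred_eq, not_forall, not_exists,
          not_and] at hH
        obtain ⟨j, hj, h⟩ := hH
        exact Set.mem_iUnion.2 ⟨⟨j, hj⟩, h⟩
    _ ≤ ∑ j : Fin n, (4 * n : ENNReal)⁻¹ :=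
        (measure_iUnion_fintype_le _ _).trans (Finset.sum_le_sum fun j _ => hblock j)
    _ = 4⁻¹ := by
        have h0 : (n : ENNReal) ≠ 0 := by exact_mod_cast (by omega : n ≠ 0)
        rw [Finset.sum_const, Finset.card_univ, Fintype.card_fin, nsmul_eq_mul,
          ENNReal.mul_inv (.inl (by norm_num)) (.inl (by norm_num)), mul_comm, mul_assoc,
          ENNReal.inv_mul_cancel h0 (by simp), mul_one]

/-! ### Failure of the construction -/

/-- If `n` items only have hash values below `q` and the admissible slots are fewer than `n`, the
construction fails. -/
theorem construct_eq_none {P : Params} {N V : ℕ∞} (H : HashFns P N) {n q : ℕ}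
    (x : Fin n → Universe N) (v : Fin n → Universe V) (hx : Function.Injective x)
    (hq : P.s + q * (P.k * P.ℓ) < n) (hH : ∀ j, H ∈ smallSet P N q (x j)) :
    construct H (Set.range fun j => (x j, v j)) = none := by
  rw [construct, dif_neg]
  rintro ⟨T, hT, hall⟩
  choose p hp using fun j => hall (x j, v j) ⟨j, rfl⟩
  -- Forgetting the bound on the entry index puts all locations and those in the first `q` entries
  -- into one type.
  let g : Location P → (Fin P.k × ℕ × Fin P.ℓ) ⊕ Fin P.s :=
    Sum.map (Prod.map id (Prod.map Fin.val id)) id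
  have hg : Function.Injective g := Function.Injective.sumMap (Function.injective_id.prodMap
    (Fin.val_injective.prodMap Function.injective_id)) Function.injective_id
  have hz (j : Fin n) : ∃ z : (Fin P.k × Fin q × Fin P.ℓ) ⊕ Fin P.s,
      Sum.map (Prod.map id (Prod.map Fin.val id)) id z = g (p j) := by
    have hadm := (hT _ _ (hp j)).2
    generalize p j = loc at hadm ⊢
    rcases loc with ⟨i, e, c⟩ | c
    · have he : e = H (i, x j) := hadm
      exact ⟨.inl (i, ⟨e, he ▸ hH j i⟩, c), rfl⟩
    · exact ⟨.inr c, rfl⟩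
  choose f hf' using hz
  have hf : Function.Injective f := by
    intro j j' h
    have hpp : p j = p j' := hg (by rw [← hf' j, ← hf' j', h])
    have := (hp j).symm.trans (hpp ▸ hp j')
    exact hx (by simpa using congrArg (Option.map Prod.fst) this)
  have := Fintype.card_le_of_injective f hf
  simp at this
  have h2 : P.k * (q * P.ℓ) = q * (P.k * P.ℓ) := by ring
  omega

/-- Witnesses from disjoint blocks are distinct: division by `B` recovers the block number. -/
theorem length_selection {O : ℕ → ℕ → ℕ} {k q n B T : ℕ} (hT : n * B ≤ T)
    (h : ∀ j < n, ∃ i < B, excess O k q (j * B + i) = 0) : (selection O k q T n).length = n := by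
  choose! f hf h0 using h
  rw [selection, List.length_take, min_eq_left]
  have hinj : Set.InjOn (fun j => j * B + f j) (Finset.range n : Set ℕ) := by
    intro j hj j' hj' h
    have hj := hf j (by simpa using hj)
    have hj' := hf j' (by simpa using hj')
    have := congrArg (· / B) h
    simpa [mul_comm _ B, Nat.mul_add_div (by omega : 0 < B), Nat.div_eq_of_lt, hj, hj'] using this
  rw [← List.toFinset_card_of_nodup (List.nodup_range.filter _)]
  calc n = (Finset.range n).card := (Finset.card_range n).symm
    _ ≤ _ := Finset.card_le_card_of_injOn _ ?_ hinj
  intro j hj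
  have hj : j < n := by simpa using hj
  have : (j + 1) * B ≤ n * B := Nat.mul_le_mul_right B hj
  rw [add_mul] at this
  have := hf j hj
  simp [h0 j hj]
  omega

/-! ### Success probability and running time of the attack -/

theorem wins_attack {d n lam q B : ℕ} {P : Params} {N V : ℕ∞} {H : HashFns P N} {ω : ℕ → Bool}
    {τ : State} {t : ℕ} (hV : 1 ≤ V) (hN : ((lam ^ d : ℕ) : ℕ∞) ≤ N)
    (hq : P.s + q * (P.k * P.ℓ) < n) (hB : n * B ≤ lam ^ d)
    (hτ : Exec (oracle H) ω (attack d) (initState n lam P) τ t)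
    (hout : τ.out = (selection (oracle H) P.k q (lam ^ d) n).map fun y => (y, 0))
    (hH : H ∈ blockSet P N q n B) : Wins (attack d) n lam P N V H ω := by
  have hlen := length_selection hB hH
  set L := selection (oracle H) P.k q (lam ^ d) n with hL
  have hmem : ∀ y ∈ L, y < lam ^ d ∧ excess (oracle H) P.k q y = 0 := fun y hy => by
    simpa using List.mem_of_mem_take hy
  have hnodup : L.Nodup := (List.nodup_range.filter _).sublist (List.take_sublist _ _)
  have hget (j : Fin n) : L[j.1]'(by omega) ∈ L := List.getElem_mem _
  let x : Fin n → Universe N := fun j =>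
    ⟨L[j.1]'(by omega), lt_of_lt_of_le (by exact_mod_cast (hmem _ (hget j)).1) hN⟩
  have hx : Function.Injective x := fun j j' h => by
    have := congrArg Subtype.val h
    exact Fin.ext ((hnodup.getElem_inj_iff).1 this)
  let v : Fin n → Universe V := fun _ => ⟨0, lt_of_lt_of_le (by norm_num) hV⟩
  refine ⟨τ, t, hτ, x, v, hx, ?_, construct_eq_none H x v hx hq fun j => ?_⟩
  · rw [hout]
    refine List.ext_getElem (by simp [hlen]) fun i h₁ h₂ => by simp [x, v]
  · exact (excess_oracle_eq_zero H q (x j)).1 (hmem _ (hget j)).2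

/-- Monotonicity and subadditivity suffice, so neither the winning event nor `S` has to be
measurable. -/
theorem half_lt_winProb_attack {d n lam q M : ℕ} {P : Params} {N V : ℕ∞} (hn : 1 ≤ n)
    (hM : 1 ≤ M) (hV : 1 ≤ V) (hN : ((lam ^ d : ℕ) : ℕ∞) ≤ N)
    (hq : P.s + q * (P.k * P.ℓ) < n) (hT : n * (4 * n * M) ≤ lam ^ d)
    (hρ : (M : ENNReal)⁻¹ ≤ smallProb P q ^ P.k)
    (hrun : ∀ (O : ℕ → ℕ → ℕ) (ω : ℕ → Bool), ∃ τ t,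
      Exec O ω (attack d) (initState n lam P) τ t ∧
      τ.out = (selection O P.k q (lam ^ d) n).map fun y => (y, 0)) :
    1 / 2 < winProb (attack d) n lam P N V := by
  set S := blockSet P N q n (4 * n * M)
  have hS : hashLaw P N S ≤ winProb (attack d) n lam P N V := by
    rw [winProb]
    calc hashLaw P N S = ((hashLaw P N).prod coinLaw) (S ×ˢ Set.univ) := by
          rw [Measure.prod_prod, measure_univ, mul_one]
      _ ≤ _ := by
          refine measure_mono fun p hp => ?_
          obtain ⟨τ, t, hτ, hout⟩ := hrun (oracle p.1) p.2
          exact wins_attack hV hN hq hT hτ hout hp.1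
  have hc : hashLaw P N Sᶜ ≤ 4⁻¹ :=
    hashLaw_compl_blockSet_le P N hn hM hρ (le_trans (by exact_mod_cast hT) hN)
  by_contra! h
  have h₁ : (1 : ENNReal) ≤ 1 / 2 + 4⁻¹ := by
    calc (1 : ENNReal) = hashLaw P N (S ∪ Sᶜ) := by rw [Set.union_compl_self, measure_univ]
      _ ≤ _ := (measure_union_le _ _).trans (add_le_add (hS.trans h) hc)
  have h₂ := ENNReal.toReal_mono (by simp) h₁
  rw [ENNReal.toReal_add (by simp) (by simp)] at h₂
  norm_num at h₂

/-- A polynomial bound on the running time of the adversary in terms of `n` and `lam`. -/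
noncomputable def timePoly (d : ℕ) : MvPolynomial (Fin 2) ℕ :=
  .X 1 ^ d * (5 * .X 0 + 10) + d * (3 * .X 1 + 4) + 3 * .X 0 + 3 * .X 0 + 9

theorem eval_timePoly (d n lam : ℕ) :
    MvPolynomial.eval ![n, lam] (timePoly d) = attackTime d n lam n := by
  simp [timePoly, attackTime]

/-- The bound `k ≤ n` turns the running time into a polynomial in `n` and `lam`; the finitely many
indices where it may fail are absorbed into `C`. -/
theorem exists_runsWithin_attack (n lam : ℕ → ℕ) (P : ℕ → Params) (N : ℕ → ℕ∞) (d : ℕ)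
    (hk : ∀ᶠ t in atTop, (P t).k ≤ n t) :
    ∃ C : ℕ, ∀ t, RunsWithin (attack d) (n t) (lam t) (P t) (N t)
      (C * MvPolynomial.eval ![n t, lam t] (timePoly d)) := by
  obtain ⟨t₀, ht₀⟩ := eventually_atTop.1 hk
  refine ⟨1 + ∑ t ∈ Finset.range t₀, attackTime d (n t) (lam t) (P t).k, fun t H ω => ?_⟩
  obtain ⟨q, -, -, h⟩ := attack_spec d (n t) (lam t) (P t)
  obtain ⟨τ, ⟨u, hu, hle⟩, -⟩ := h (oracle H) ω
  refine ⟨τ, u, hu, hle.trans ?_⟩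
  rw [eval_timePoly]
  have hpos : 1 ≤ attackTime d (n t) (lam t) (n t) := by unfold attackTime; omega
  rcases lt_or_ge t t₀ with ht | ht
  · calc attackTime d (n t) (lam t) (P t).k
        ≤ ∑ t ∈ Finset.range t₀, attackTime d (n t) (lam t) (P t).k :=
          Finset.single_le_sum (f := fun t => attackTime d (n t) (lam t) (P t).k)
            (fun _ _ => Nat.zero_le _) (Finset.mem_range.2 ht)
      _ ≤ 1 + ∑ t ∈ Finset.range t₀, attackTime d (n t) (lam t) (P t).k := Nat.le_add_left _ _
      _ ≤ _ := Nat.le_mul_of_pos_right _ hpos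
  · calc attackTime d (n t) (lam t) (P t).k ≤ attackTime d (n t) (lam t) (n t) := by
          unfold attackTime; gcongr <;> exact ht₀ t ht
      _ ≤ _ := Nat.le_mul_of_pos_left _ (by omega)

/-! ### Asymptotic estimates and conclusion -/

theorem m_le_mul_threshold {P : Params} {n q D : ℕ} {C : ℝ} (hC : 4 * C ≤ D)
    (hb : (P.b : ℝ) ≤ C * (n / P.ℓ)) (hs : 2 * P.s ≤ n) (hq : 1 ≤ q)
    (hn : n ≤ P.s + (q + 1) * (P.k * P.ℓ)) : P.m ≤ D * q := by
  have hℓ : (0 : ℝ) < P.ℓ := by exact_mod_cast P.ℓ_pos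
  have hk : (0 : ℝ) < P.k := by exact_mod_cast P.k_pos
  have hmk : (P.m : ℝ) * P.k = P.b := by exact_mod_cast Nat.div_mul_cancel P.k_dvd_b
  have hs' : 2 * (P.s : ℝ) ≤ n := by exact_mod_cast hs
  have hq' : (1 : ℝ) ≤ q := by exact_mod_cast hq
  have hn' : (n : ℝ) ≤ P.s + (q + 1) * (P.k * P.ℓ) := by exact_mod_cast hn
  -- From `n / 2 ≤ n - s ≤ (q + 1) * k * ℓ ≤ 2 * q * k * ℓ`.
  have h4 : (n : ℝ) ≤ 4 * (q * (P.k * P.ℓ)) := by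
    nlinarith [mul_le_mul_of_nonneg_right hq' (mul_pos hk hℓ).le]
  have hbl : (P.b : ℝ) * P.ℓ ≤ C * n := by
    rwa [← mul_div_assoc, le_div_iff₀ hℓ] at hb
  have hCD : 4 * (C * n) ≤ D * n := by
    nlinarith [mul_le_mul_of_nonneg_right hC (Nat.cast_nonneg (α := ℝ) n)]
  have hfin : (P.m : ℝ) * (P.k * P.ℓ) ≤ (D * q) * (P.k * P.ℓ) := by
    rw [← mul_assoc, hmk]
    nlinarith [mul_le_mul_of_nonneg_left h4 (Nat.cast_nonneg (α := ℝ) D)]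
  exact_mod_cast le_of_mul_le_mul_right hfin (mul_pos hk hℓ)

/-- In logarithms: `k * log D ≤ a * c * k ≤ a * log lam`. -/
theorem pow_le_pow_of_mul_lt_log {D k lam a : ℕ} {c : ℝ} (hD : 1 ≤ D) (hc : 0 < c)
    (hlam : 1 ≤ lam) (ha : Real.log D / c ≤ a) (hk : c * k ≤ Real.log lam) :
    D ^ k ≤ lam ^ a := by
  have hD' : (0 : ℝ) < D := by exact_mod_cast hD
  have hl' : (0 : ℝ) < lam := by exact_mod_cast hlam
  rw [div_le_iff₀ hc] at ha
  have h : Real.log ((D : ℝ) ^ k) ≤ Real.log ((lam : ℝ) ^ a) := by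
    rw [Real.log_pow, Real.log_pow]
    nlinarith [mul_le_mul_of_nonneg_left ha (Nat.cast_nonneg (α := ℝ) k),
      mul_le_mul_of_nonneg_left hk (Nat.cast_nonneg (α := ℝ) a)]
  exact_mod_cast (Real.log_le_log_iff (by positivity) (by positivity)).1 h

end Cuckoo

open Cuckoo in
theorem mainTheorem7 (n lam : ℕ → ℕ) (P : ℕ → Cuckoo.Params) (N V : ℕ → ℕ∞)
    (hn : Tendsto n atTop atTop)
    (hlam : ∀ t, n t ≤ lam t)
    (hN : ∀ c : ℕ, ∀ᶠ t in atTop, ((lam t ^ c : ℕ) : ℕ∞) ≤ N t)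
    (hV : ∀ t, 1 ≤ V t)
    (hℓ : (fun t => ((P t).ℓ : ℝ)) =o[atTop] fun t => (n t : ℝ))
    (hs : (fun t => ((P t).s : ℝ)) =o[atTop] fun t => (n t : ℝ))
    (hb : (fun t => ((P t).b : ℝ)) =O[atTop] fun t => (n t : ℝ) / ((P t).ℓ : ℝ))
    (hq : ∀ᶠ t in atTop, (P t).k * (P t).ℓ + (P t).s < n t)
    (hrob : Cuckoo.PolyRobust n lam P N V (1 / 2)) :
    (fun t => Real.log (lam t : ℝ)) =o[atTop] fun t => ((P t).k : ℝ) := by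
  rw [isLittleO_iff]
  by_contra! h
  obtain ⟨c, hc, hfreq⟩ := h
  obtain ⟨C, hC⟩ := hb.bound
  set D : ℕ := ⌈4 * C⌉₊ + 1 with hD
  set a : ℕ := ⌈Real.log D / c⌉₊ with ha
  have hCD : 4 * C ≤ D := (Nat.le_ceil _).trans (by rw [hD]; push_cast; linarith)
  have hk : ∀ᶠ t in atTop, (P t).k ≤ n t := hq.mono fun t ht => by
    have := Nat.le_mul_of_pos_right (P t).k (P t).ℓ_pos
    omega
  -- The exponent `a` pays for the rarity of small identifiers, and `3` for the factor `4 * n * n ≤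
  -- lam ^ 3`, valid once `n ≥ 4`.
  have hwin := hrob (timePoly (a + 3)) (attack (a + 3))
    (exists_runsWithin_attack n lam P N (a + 3) hk)
  have hs2 := hs.bound (by norm_num : (0 : ℝ) < 1 / 2)
  obtain ⟨t, hlog, hCt, hqt, hwt, hst, hnt, hNt⟩ := (hfreq.and_eventually
    (hC.and (hq.and (hwin.and (hs2.and ((hn.eventually_ge_atTop 4).and (hN (a + 3)))))))).exists
  have hlt := hlam t
  obtain ⟨q, hq₁, hq₂, hrun⟩ := attack_spec (a + 3) (n t) (lam t) (P t)
  -- For `q = 0`, maximality would give `n ≤ s + k * ℓ`, against the query overhead bound.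
  have hq₀ : 1 ≤ q := by
    rcases Nat.eq_zero_or_pos q with rfl | h
    · omega
    · exact h
  have hlam₁ : (1 : ℝ) ≤ lam t := by exact_mod_cast (by omega : 1 ≤ lam t)
  have hm : (P t).m ≤ D * q := by
    refine m_le_mul_threshold hCD ?_ ?_ hq₀ hq₂
    · rwa [Real.norm_of_nonneg (by positivity), Real.norm_of_nonneg (by positivity)] at hCt
    · rw [Real.norm_of_nonneg (by positivity), Real.norm_of_nonneg (by positivity)] at hst
      exact_mod_cast (by linarith : 2 * ((P t).s : ℝ) ≤ n t)
  have hpow : D ^ (P t).k ≤ lam t ^ a := by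
    refine pow_le_pow_of_mul_lt_log (by omega) hc (by omega) (Nat.le_ceil _) ?_
    rw [Real.norm_of_nonneg (by positivity), Real.norm_of_nonneg (Real.log_nonneg hlam₁)] at hlog
    exact hlog.le
  refine absurd hwt (not_le.2 (half_lt_winProb_attack (M := lam t ^ a) (q := q) (by omega)
    (Nat.one_le_pow _ _ (by omega)) (hV t) hNt (hq₁.resolve_left (by omega)) ?_
    (inv_le_smallProb_pow (P t) (by omega) hm hpow) fun O ω => ?_))
  · calc n t * (4 * n t * lam t ^ a) ≤ lam t * (lam t * lam t * lam t ^ a) := by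
          gcongr; omega
      _ = lam t ^ (a + 3) := by ring
  · obtain ⟨τ, ⟨u, hu, -⟩, hout⟩ := hrun O ω
    exact ⟨τ, u, hu, hout⟩
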